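/- Let $A$ be a basic artin algebra over a commutative artinian ring $R$, and let $\{e_x\}_{x\in A_0}$ be a complete set of primitive orthogonal idempotents of $A$ (basic means that the modules $e_xA$ are pairwise non-isomorphic). Let $\operatorname{mod}A$ be the category of finitely generated right $A$-modules, $\operatorname{ind}A$ the full subcategory of indecomposable modules (up to isomorphism), and $D=\operatorname{Hom}_R(-,E)$ the standard duality, where $E$ is the injective envelope of $R/\operatorname{rad}R$. Put $P_x=e_xA$ and $I_x=D(Ae_x)$. For $M,N\in\operatorname{ind}A$ write $M\leadsto N$ if there is a sequence of nonzero morphisms $M=X_0\to X_1\to\cdots\to X_t=N$ with $t\ge 1$ and all $X_i\in\operatorname{ind}A$. Let $$\mathcal L_A=\{M\in\operatorname{ind}A \mid \operatorname{pd}L\le 1\text{ whenever }L\leadsto M\},\qquad \mathcal R_A=\{M\in\operatorname{ind}A\mid \operatorname{id}N\le 1\text{ whenever }M\leadsto N\}.$$ The algebra $A$ is called an ada algebra if $A\oplus DA\in\operatorname{add}(\mathcal L_A\cup\mathcal R_A)$. The left support $A_\lambda$ of $A$ is the endomorphism algebra of the direct sum of the $P_x$ lying in $\mathcal L_A$, that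 is, the full subcategory $A_\lambda=\varepsilon A\varepsilon$ of $A$ with $\varepsilon=\sum_{P_x\in\mathcal L_A}e_x$; the right support $A_\rho$ is, dually, the endomorphism algebra of the direct sum of the $I_x$ lying in $\mathcal R_A$, that is, the full subcategory $A_\rho=\varepsilon' A\varepsilon'$ of $A$ with $\varepsilon'=\sum_{I_x\in\mathcal R_A}e_x$. Modules over $A_\lambda$ and $A_\rho$ are regarded as $A$-modules via extension by zero, so that $\operatorname{ind}A_\lambda$ and $\operatorname{ind}A_\rho$ are subcategories of $\operatorname{ind}A$. Theorem. The algebra $A$ is ada if and only if $$\operatorname{ind}A=\mathcal L_A\cup\operatorname{ind}A_\rho\quad\text{and}\quad\operatorname{ind}A=\operatorname{ind}A_\lambda\cup\mathcal R_A.$$ In particular, if $A$ is ada, then $\operatorname{ind}A=\operatorname{ind}A_\lambda\cup\operatorname{ind}A_\rho$. -/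

import Mathlib

open CategoryTheory

universe u v

namespace Ada

/-! ## Injective envelopes -/

section InjectiveEnvelope

variable {R : Type u} [Ring R]

/-- `i : N → E` exhibits `E` as an injective envelope of `N`: an essential embedding of `N` into an
injective module. -/
structure IsInjectiveEnvelope {N E : Type u} [AddCommGroup N] [Module R N] [AddCommGroup E]
    [Module R E] (i : N →ₗ[R] E) : Prop where
  injective_module : Module.Injective R E
  injective_map : Function.Injective i
  essential : ∀ S : Submodule R E, S ⊓ LinearMap.range i = ⊥ → S = ⊥

/-- A submodule `E` of an injective module that is maximal among the essential extensions of `N`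
is injective. -/
theorem injective_of_maximal_essential {J : Type u} [AddCommGroup J] [Module R J]
    (hJ : Module.Injective R J) (N E : Submodule R J)
    (hess : ∀ S : Submodule R J, S ≤ E → S ⊓ N = ⊥ → S = ⊥)
    (hmax : ∀ E' : Submodule R J, E ≤ E' →
      (∀ S : Submodule R J, S ≤ E' → S ⊓ N = ⊥ → S = ⊥) → E' ≤ E) :
    Module.Injective R E := by
  obtain ⟨C, hC0, hCmax⟩ : ∃ C : Submodule R J, C ⊓ E = ⊥ ∧
      ∀ C' : Submodule R J, C ≤ C' → C' ⊓ E = ⊥ → C' ≤ C := by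
    obtain ⟨C, hC⟩ := zorn_le₀ {C : Submodule R J | C ⊓ E = ⊥} (by
      intro c hc hchain
      refine ⟨sSup c, ?_, fun z hz => le_sSup hz⟩
      rcases c.eq_empty_or_nonempty with rfl | hne
      · simp
      · rw [Set.mem_ofPred_eq, eq_bot_iff]
        rintro x ⟨hx1, hx2⟩
        obtain ⟨z, hz, hxz⟩ := (Submodule.mem_sSup_of_directed hne hchain.directedOn).1 hx1
        have hzE : z ⊓ E = ⊥ := hc hz
        rw [← hzE]
        exact ⟨hxz, hx2⟩)
    exact ⟨C, hC.prop, fun C' h1 h2 => hC.le_of_ge h2 h1⟩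
  let f : E →ₗ[R] (J ⧸ C) := C.mkQ ∘ₗ E.subtype
  have hf : Function.Injective f := by
    rw [← LinearMap.ker_eq_bot, eq_bot_iff]
    intro x hx
    have h1 : (x : J) ∈ C ⊓ E := ⟨(Submodule.Quotient.mk_eq_zero C).1 hx, x.2⟩
    rw [hC0] at h1
    exact (Submodule.mem_bot R).2 (Subtype.ext ((Submodule.mem_bot R).1 h1))
  obtain ⟨g, hg⟩ := hJ.out f hf E.subtype
  have hgE : ∀ x (hx : x ∈ E), g (C.mkQ x) = x := fun x hx => hg ⟨x, hx⟩
  have hker : LinearMap.ker g = ⊥ := by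
    have hle : (LinearMap.ker g).comap C.mkQ ≤ C := by
      apply hCmax
      · intro x hx
        have : C.mkQ x = 0 := (Submodule.Quotient.mk_eq_zero C).2 hx
        simp [this]
      · rw [eq_bot_iff]
        rintro x ⟨hx1, hx2⟩
        have h := hgE x hx2
        rw [Submodule.mem_bot, ← h]
        exact hx1
    rw [eq_bot_iff]
    intro y hy
    obtain ⟨x, rfl⟩ := C.mkQ_surjective y
    exact (Submodule.mem_bot R).2 ((Submodule.Quotient.mk_eq_zero C).2 (hle hy))
  have hrange : LinearMap.range g ≤ E := by
    apply hmax
    · intro x hx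
      exact ⟨_, hgE x hx⟩
    · intro S hS hSN
      have hSE : S ⊓ E = ⊥ := by
        apply hess _ inf_le_right
        rw [eq_bot_iff, ← hSN]
        exact inf_le_inf_right N inf_le_left
      have hle : (S.comap g).comap C.mkQ ≤ C := by
        apply hCmax
        · intro x hx
          have : C.mkQ x = 0 := (Submodule.Quotient.mk_eq_zero C).2 hx
          simp [this]
        · rw [eq_bot_iff, ← hSE]
          rintro x ⟨hx1, hx2⟩
          have hx3 : g (C.mkQ x) ∈ S := hx1
          rw [hgE x hx2] at hx3
          exact ⟨hx3, hx2⟩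
      rw [eq_bot_iff]
      intro s hs
      obtain ⟨y, rfl⟩ := hS hs
      obtain ⟨x, rfl⟩ := C.mkQ_surjective y
      have : C.mkQ x = 0 := (Submodule.Quotient.mk_eq_zero C).2 (hle hs)
      simp [this]
  let r : J →ₗ[R] E := (g ∘ₗ C.mkQ).codRestrict E (fun x => hrange ⟨_, rfl⟩)
  refine ⟨fun X Y _ _ _ _ k hk h => ?_⟩
  obtain ⟨h', hh'⟩ := hJ.out k hk (E.subtype ∘ₗ h)
  refine ⟨r ∘ₗ h', fun x => Subtype.ext ?_⟩
  change g (C.mkQ (h' (k x))) = _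
  rw [hh' x]
  exact hgE _ (h x).2

theorem exists_isInjectiveEnvelope (N : Type u) [AddCommGroup N] [Module R N] :
    ∃ (E : ModuleCat.{u} R) (i : N →ₗ[R] E), IsInjectiveEnvelope i := by
  obtain ⟨J, hJinj, j, hj⟩ := EnoughInjectives.presentation (ModuleCat.of R N)
  have hJ : Module.Injective R J := (Module.injective_iff_injective_object R J).2 hJinj
  have hjinj : Function.Injective j.hom := (ModuleCat.mono_iff_injective j).1 hj
  let N' : Submodule R J := LinearMap.range j.hom
  obtain ⟨E, hNE, hE⟩ := zorn_le_nonempty₀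
    {E : Submodule R J | N' ≤ E ∧ ∀ S : Submodule R J, S ≤ E → S ⊓ N' = ⊥ → S = ⊥} (by
      intro c hc hchain y hy
      refine ⟨sSup c, ⟨(hc hy).1.trans (le_sSup hy), ?_⟩, fun z hz => le_sSup hz⟩
      intro S hS hSN
      rw [eq_bot_iff]
      intro s hs
      obtain ⟨z, hz, hsz⟩ :=
        (Submodule.mem_sSup_of_directed ⟨y, hy⟩ hchain.directedOn).1 (hS hs)
      have h : S ⊓ z = ⊥ := by
        apply (hc hz).2 _ inf_le_right
        rw [eq_bot_iff, ← hSN]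
        exact inf_le_inf_right N' inf_le_left
      rw [← h]
      exact ⟨hs, hsz⟩)
    N' ⟨le_rfl, fun S h1 h2 => by rwa [inf_eq_left.2 h1] at h2⟩
  refine ⟨ModuleCat.of R E, j.hom.codRestrict E (fun x => hNE ⟨x, rfl⟩), ?_, ?_, ?_⟩
  · exact injective_of_maximal_essential hJ N' E hE.prop.2
      (fun E' h1 h2 => hE.le_of_ge ⟨hNE.trans h1, h2⟩ h1)
  · intro x y hxy
    exact hjinj (congrArg Subtype.val hxy)
  · intro S hS
    have hS' : S.map E.subtype = ⊥ := by
      apply hE.prop.2 _ (Submodule.map_subtype_le E S)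
      rw [eq_bot_iff]
      rintro _ ⟨⟨s, hs, rfl⟩, ⟨n, hn⟩⟩
      have hs0 : s ∈ S ⊓ LinearMap.range (j.hom.codRestrict E (fun x => hNE ⟨x, rfl⟩)) :=
        ⟨hs, n, Subtype.ext hn⟩
      have hs1 : s = 0 := by
        have := hS.le hs0
        exact (Submodule.mem_bot R).1 this
      simp [hs1]
    exact Submodule.map_injective_of_injective E.injective_subtype (by rw [hS', Submodule.map_bot])

/-- The injective envelope of a module. -/
noncomputable def injectiveEnvelope (N : Type u) [AddCommGroup N] [Module R N] : ModuleCat.{u} R :=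
  Classical.choose (exists_isInjectiveEnvelope (R := R) N)

theorem injectiveEnvelope_spec (N : Type u) [AddCommGroup N] [Module R N] :
    ∃ i : N →ₗ[R] injectiveEnvelope (R := R) N, IsInjectiveEnvelope i :=
  Classical.choose_spec (exists_isInjectiveEnvelope (R := R) N)

end InjectiveEnvelope

/-! ## The standard duality

For an artin algebra `A` over `R`, the functor `D = Hom_R(-, E)`, where `E` is the injective
envelope of `R / rad R`, turns left `A`-modules into right `A`-modules.  Right `A`-modules are
modules over `Aᵐᵒᵖ`. -/

/-- The injective envelope of `R / rad R`. -/
noncomputable abbrev dualizingModule (R : Type u) [CommRing R] : ModuleCat.{u} R :=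
  injectiveEnvelope (R := R) (R ⧸ Ring.jacobson R)

/-- The dual `D N = Hom_R(N, E)` of an `R`-module `N`. -/
def StdDual (R : Type u) [CommRing R] (N : Type u) [AddCommGroup N] [Module R N] : Type u :=
  N →ₗ[R] dualizingModule R

section StdDual

variable (R : Type u) [CommRing R] {A : Type u} [Ring A] [Algebra R A]
  (N : Type u) [AddCommGroup N] [Module R N] [Module A N] [IsScalarTower R A N]

noncomputable instance : AddCommGroup (StdDual R N) :=
  inferInstanceAs (AddCommGroup (N →ₗ[R] dualizingModule R))

instance : FunLike (StdDual R N) N (dualizingModule R) :=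
  inferInstanceAs (FunLike (N →ₗ[R] dualizingModule R) N (dualizingModule R))

instance : LinearMapClass (StdDual R N) R N (dualizingModule R) :=
  inferInstanceAs (LinearMapClass (N →ₗ[R] dualizingModule R) R N (dualizingModule R))

/-- The right `A`-action on `D N` is `(f · a) n = f (a n)`. -/
noncomputable instance : Module Aᵐᵒᵖ (StdDual R N) where
  smul a f := LinearMap.comp f (Algebra.lsmul R R N a.unop)
  one_smul f := DFunLike.ext _ _ fun n => congrArg f (one_smul A n)
  mul_smul a b f := DFunLike.ext _ _ fun n => congrArg f (mul_smul b.unop a.unop n)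
  smul_zero _ := rfl
  smul_add _ _ _ := rfl
  add_smul a b f := DFunLike.ext _ _ fun n =>
    (congrArg f (add_smul a.unop b.unop n)).trans (map_add f _ _)
  zero_smul f := DFunLike.ext _ _ fun n => (congrArg f (zero_smul A n)).trans (map_zero f)

theorem StdDual.op_smul_apply (a : A) (f : StdDual R N) (n : N) :
    (MulOpposite.op a • f) n = f (a • n) := rfl

end StdDual

/-! ## Indecomposable modules, and the left and right parts -/

/-- The objects of `ind B`: finitely generated indecomposable right `B`-modules. (All of them,
not only one representative of each isomorphism class; the sets of indecomposable modules below
are closed under isomorphism.) -/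
structure Ind (B : Type u) [Ring B] where
  obj : ModuleCat.{u} Bᵐᵒᵖ
  finite : Module.Finite Bᵐᵒᵖ obj
  indecomposable : Indecomposable obj

section Parts

variable (A : Type u) [Ring A]

variable {A} in
/-- `Path M N` is `M ⇝ N`: there is a sequence `M = X₀ → X₁ → ⋯ → X_t = N`, `t ≥ 1`, of nonzero
morphisms between indecomposable modules. -/
def Path (M N : Ind A) : Prop :=
  Relation.TransGen (fun X Y : Ind A => ∃ f : X.obj ⟶ Y.obj, f ≠ 0) M N

/-- The left part `L_A`. -/
def leftPart : Set (Ind A) :=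
  {M | ∀ L : Ind A, Path L M → HasProjectiveDimensionLE L.obj 1}

/-- The right part `R_A`. -/
def rightPart : Set (Ind A) :=
  {M | ∀ N : Ind A, Path M N → HasInjectiveDimensionLE N.obj 1}

variable {A}

/-- The module `M` is indecomposable and lies in the subcategory `C` of `ind A`. -/
def LiesIn (C : Set (Ind A)) (M : ModuleCat.{u} Aᵐᵒᵖ) : Prop :=
  ∃ X ∈ C, Nonempty (M ≅ X.obj)

/-- The module `M` lies in `add C`, i.e. is isomorphic to a finite direct sum of modules in `C`.
(A nonzero summand of an indecomposable module is that module.) -/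
def InAdd (C : Set (Ind A)) (M : ModuleCat.{u} Aᵐᵒᵖ) : Prop :=
  ∃ (n : ℕ) (X : Fin n → Ind A), (∀ i, X i ∈ C) ∧
    Nonempty (M ≃ₗ[Aᵐᵒᵖ] ((i : Fin n) → (X i).obj))

end Parts

/-- An artin `R`-algebra `A` is an ada algebra if `A ⊕ D A` lies in `add (L_A ∪ R_A)`. -/
def IsAda (R : Type u) [CommRing R] (A : Type u) [Ring A] [Algebra R A] : Prop :=
  InAdd (leftPart A ∪ rightPart A) (ModuleCat.of Aᵐᵒᵖ (A × StdDual R A))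

/-! ## Projective and injective modules attached to idempotents -/

section Idempotents

variable {A : Type u} [Ring A]

/-- The right module `eA`. -/
abbrev projModule (e : A) : Submodule Aᵐᵒᵖ A := Submodule.span Aᵐᵒᵖ {e}

/-- The right module `D(Ae)`. -/
abbrev injModule (R : Type u) [CommRing R] [Algebra R A] (e : A) : Type u :=
  StdDual R (Submodule.span A {e})

/-- `(e_x)` is a complete set of primitive orthogonal idempotents of the basic algebra `A`;
the algebra `A` is basic if the modules `e_x A` are pairwise non-isomorphic. -/
structure IsBasicIdempotentSystem {ι : Type v} [Fintype ι] (e : ι → A) : Prop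
    extends CompleteOrthogonalIdempotents e where
  ne_zero : ∀ x, e x ≠ 0
  primitive : ∀ x (f g : A), IsIdempotentElem f → IsIdempotentElem g → f * g = 0 → g * f = 0 →
    f + g = e x → f = 0 ∨ g = 0
  basic : ∀ x y, Nonempty (projModule (e x) ≃ₗ[Aᵐᵒᵖ] projModule (e y)) → x = y

end Idempotents

/-! ## Full subcategories and supports -/

section Supports

variable {A : Type u} [Ring A] {ι : Type v} [Fintype ι] {e : ι → A}

open Classical in
/-- The idempotent `∑_{x ∈ S} e_x`. -/
noncomputable def supportIdempotent (e : ι → A) (S : Set ι) : A := ∑ x ∈ S.toFinset, e x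

theorem isIdempotentElem_support (he : OrthogonalIdempotents e) (S : Set ι) :
    IsIdempotentElem (supportIdempotent e S) :=
  he.isIdempotentElem_sum

/-- The full subcategory `B = εAε`, `ε = ∑_{x ∈ S} e_x`, of `A` with object set `S`. -/
abbrev FullSubcat (he : OrthogonalIdempotents e) (S : Set ι) : Type u :=
  (isIdempotentElem_support he S).Corner

theorem mem_projModule_iff {f : A} (hf : IsIdempotentElem f) (a : A) :
    a ∈ projModule f ↔ f * a = a := by
  rw [Submodule.mem_span_singleton]
  constructor
  · rintro ⟨b, rfl⟩
    change f * (f * b.unop) = f * b.unop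
    rw [← mul_assoc, hf.eq]
  · intro h
    exact ⟨MulOpposite.op a, h⟩

open Classical in
/-- The full subcategory `εAε` with object set `S` is the endomorphism algebra of the direct sum
of the right modules `e_x A`, `x ∈ S`. -/
noncomputable def fullSubcatEquivEnd (he : OrthogonalIdempotents e) (S : Set ι) :
    FullSubcat he S ≃+* Module.End Aᵐᵒᵖ ((x : S) → projModule (e x)) := by
  have hsum : supportIdempotent e S = ∑ x : S, e x := by
    rw [supportIdempotent, Finset.sum_subtype S.toFinset (p := (· ∈ S)) (by simp)]
  have hmem : ∀ (x : S) (p : projModule (e x)), e x * p = p := fun x p =>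
    (mem_projModule_iff (he.idem x) _).1 p.2
  have horth : ∀ (y z : S) (p : projModule (e z)), e y * (p : A) = if y = z then (p : A) else 0 := by
    intro y z p
    split_ifs with h
    · subst h; exact hmem y p
    · rw [← hmem z p, ← mul_assoc, he.ortho (fun h' => h (Subtype.ext h')), zero_mul]
  have hes : ∀ (p : (x : S) → projModule (e x)) (y : S), e y * ∑ z, (p z : A) = p y := by
    intro p y
    rw [Finset.mul_sum, Finset.sum_eq_single y]
    · exact hmem y _
    · intro z _ hz
      rw [horth, if_neg (fun h => hz h.symm)]
    · simp
  have hεs : ∀ (p : (x : S) → projModule (e x)),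
      supportIdempotent e S * ∑ z, (p z : A) = ∑ z, (p z : A) := by
    intro p
    rw [hsum, Finset.sum_mul]
    exact Finset.sum_congr rfl fun y _ => hes p y
  let u : (x : S) → projModule (e x) := fun x => ⟨e x, Submodule.mem_span_singleton_self _⟩
  have hcorner : ∀ b : FullSubcat he S,
      supportIdempotent e S * b.1 = b.1 ∧ b.1 * supportIdempotent e S = b.1 := fun b =>
    (Subsemigroup.mem_corner_iff (isIdempotentElem_support he S)).1 b.2
  let F : FullSubcat he S → Module.End Aᵐᵒᵖ ((x : S) → projModule (e x)) := fun b =>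
    { toFun := fun p x => ⟨e x * (b.1 * ∑ z, (p z : A)), (mem_projModule_iff (he.idem x) _).2 (by
        rw [← mul_assoc, (he.idem x).eq])⟩
      map_add' := fun p q => funext fun x => Subtype.ext (by
        simp [Finset.sum_add_distrib, mul_add])
      map_smul' := fun a p => funext fun x => Subtype.ext (by
        simp [← Finset.sum_mul, mul_assoc]) }
  have hFsum : ∀ b p, ∑ x : S, ((F b p x : projModule (e x)) : A) = b.1 * ∑ z, (p z : A) := by
    intro b p
    change ∑ x : S, e x * (b.1 * ∑ z, (p z : A)) = _
    rw [← Finset.sum_mul, ← hsum, ← mul_assoc, (hcorner b).1]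
  have hFval : ∀ b p (x : S), ((F b p x : projModule (e x)) : A) = e x * (b.1 * ∑ z, (p z : A)) :=
    fun _ _ _ => rfl
  have hG : ∀ φ : Module.End Aᵐᵒᵖ ((x : S) → projModule (e x)),
      (∑ x, (φ u x : A)) ∈ Subsemigroup.corner (supportIdempotent e S) := by
    intro φ
    rw [Subsemigroup.mem_corner_iff (isIdempotentElem_support he S)]
    refine ⟨hεs _, ?_⟩
    have h : MulOpposite.op (supportIdempotent e S) • u = u := by
      funext x
      apply Subtype.ext
      change e x * supportIdempotent e S = e x
      rw [hsum]
      exact hes u x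
    conv_rhs => rw [← h]
    rw [map_smul, Finset.sum_mul]
    rfl
  exact
  { toFun := F
    invFun := fun φ => ⟨∑ x, (φ u x : A), hG φ⟩
    left_inv := fun b => Subtype.ext (by
      change ∑ x : S, ((F b u x : projModule (e x)) : A) = b.1
      rw [hFsum]
      change b.1 * ∑ z : S, e z = b.1
      rw [← hsum, (hcorner b).2])
    right_inv := fun φ => by
      refine LinearMap.ext fun p => funext fun x => Subtype.ext ?_
      change e x * ((∑ y : S, (φ u y : A)) * ∑ z : S, (p z : A)) = _
      rw [← mul_assoc, hes]
      have h : MulOpposite.op (∑ z, (p z : A)) • u = p := by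
        funext y
        exact Subtype.ext (hes p y)
      conv_rhs => rw [← h, map_smul]
      rfl
    map_mul' := fun a b => by
      refine LinearMap.ext fun p => funext fun x => Subtype.ext ?_
      rw [Module.End.mul_apply, hFval, hFval, hFsum]
      change e x * (a.1 * b.1 * _) = _
      rw [mul_assoc]
    map_add' := fun a b => by
      refine LinearMap.ext fun p => funext fun x => Subtype.ext ?_
      change e x * ((a.1 + b.1) * _) = e x * (a.1 * _) + e x * (b.1 * _)
      rw [add_mul, mul_add] }

/-- The element `εaε` of `B = εAε`. -/
noncomputable def compress (he : OrthogonalIdempotents e) (S : Set ι) (a : A) : FullSubcat he S :=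
  ⟨supportIdempotent e S * a * supportIdempotent e S, a, rfl⟩

/-- `ind B` as a subcategory of `ind A`, for the full subcategory `B = εAε` of `A`: the
indecomposable `A`-modules `M` obtained from some indecomposable `B`-module `X` via extension by
zero, i.e. `M` is `X` as an abelian group, with `a ∈ A` acting on `M` as `εaε ∈ B` acts on `X`. -/
def indFullSubcat (he : OrthogonalIdempotents e) (S : Set ι) : Set (Ind A) :=
  {M | ∃ (X : Ind (FullSubcat he S)) (φ : M.obj ≃+ X.obj),
    ∀ (a : A) (m : M.obj),
      φ (MulOpposite.op a • m) = MulOpposite.op (compress he S a) • φ m}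

/-- The objects `x` of the left support: those for which `P_x = e_x A` lies in `L_A`. -/
def leftSupportObj (e : ι → A) : Set ι :=
  {x | LiesIn (leftPart A) (ModuleCat.of Aᵐᵒᵖ (projModule (e x)))}

/-- The objects `x` of the right support: those for which `I_x = D(A e_x)` lies in `R_A`. -/
def rightSupportObj (R : Type u) [CommRing R] [Algebra R A] (e : ι → A) : Set ι :=
  {x | LiesIn (rightPart A) (ModuleCat.of Aᵐᵒᵖ (injModule R (e x)))}

/-- The left support `A_λ = End P`, `P` the direct sum of the `P_x` lying in `L_A`, realised as the
full subcategory `εAε` of `A` (see `fullSubcatEquivEnd` for the isomorphism). -/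
abbrev LeftSupport (he : OrthogonalIdempotents e) : Type u :=
  FullSubcat he (leftSupportObj e)

/-- The right support `A_ρ`, defined dually: the endomorphism algebra of the direct sum of the
`I_x` lying in `R_A`, realised as the full subcategory `εAε` of `A`. -/
abbrev RightSupport (R : Type u) [CommRing R] [Algebra R A] (he : OrthogonalIdempotents e) :
    Type u :=
  FullSubcat he (rightSupportObj R e)

/-- `ind A_λ` inside `ind A`. -/
def indLeftSupport (he : OrthogonalIdempotents e) : Set (Ind A) :=
  indFullSubcat he (leftSupportObj e)

/-- `ind A_ρ` inside `ind A`. -/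
def indRightSupport (R : Type u) [CommRing R] [Algebra R A] (he : OrthogonalIdempotents e) :
    Set (Ind A) :=
  indFullSubcat he (rightSupportObj R e)

end Supports

end Ada

namespace Ada

/-! ## Matlis duality for modules of finite length -/

section Matlis

variable {R : Type u} [CommRing R]

/-! The homological conditions enter only through one formal consequence: the left part is closed
under predecessors and the right part under successors (`leftPart_of_path`, `rightPart_of_path`).
The rest is a study of supports. A module M comes from the full subcategory on S exactly when M e_x
= 0 for all x outside S (`mem_indFullSubcat_iff`), and M e_x ≠ 0 yields nonzero maps P_x → M and M →
I_x.

Let A be ada. By Krull–Schmidt every P_x and every I_x lies in the left or the right part. If M is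
not supported on A_λ, some P_x outside the left part maps nontrivially to M; this P_x is in the
right part, hence so is M. If M is not supported on A_ρ, some I_x outside the right part receives a
nonzero map from M; this I_x is in the left part, hence so is M. Conversely, P_x e_x and I_x e_x are
nonzero, so P_x is supported on A_λ only if it lies in the left part, and I_x on A_ρ only if it lies
in the right part; the two equalities therefore place all summands of A ⊕ DA. The last assertion
follows from `leftPart_subset_indLeftSupport`.

The technical cost is that I_x must be known to be finitely generated and indecomposable. Both come
from a weak form of Matlis duality: `length_hom_le`, the double annihilator property and the
cogenerator property of E. -/

theorem IsInjectiveEnvelope.mem_range_of_smul_eq_zero {N E : Type u} [AddCommGroup N] [Module R N]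
    [AddCommGroup E] [Module R E] {i : N →ₗ[R] E} (h : IsInjectiveEnvelope i) (m : Ideal R)
    [hm : m.IsMaximal] {y : E} (hy : ∀ r ∈ m, r • y = 0) : y ∈ LinearMap.range i := by
  by_cases hy0 : y = 0
  · exact hy0 ▸ zero_mem _
  have hne : Submodule.span R {y} ⊓ LinearMap.range i ≠ ⊥ := fun h0 =>
    hy0 (Submodule.span_singleton_eq_bot.1 (h.essential _ h0))
  obtain ⟨z, ⟨hz1, hz2⟩, hz0⟩ := Submodule.exists_mem_ne_zero_of_ne_bot hne
  obtain ⟨r, rfl⟩ := Submodule.mem_span_singleton.1 hz1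
  have hr : r ∉ m := fun hr => hz0 (hy r hr)
  obtain ⟨t, s, hs, hts⟩ := hm.exists_inv hr
  have : y = t • r • y := by
    conv_lhs => rw [← one_smul R y, ← hts, add_smul, hy s hs, add_zero, mul_smul]
  rw [this]
  exact Submodule.smul_mem _ _ hz2

theorem mem_jacobson_of_mul_self_mem {r : R} (h : r * r ∈ Ring.jacobson R) :
    r ∈ Ring.jacobson R := by
  rw [Ring.jacobson, Module.jacobson, Submodule.mem_sInf] at h ⊢
  intro m hm
  have : Ideal.IsMaximal m := ⟨hm⟩
  exact (this.isPrime.mem_or_mem (h m hm)).elim id id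

theorem jacobson_le_of_isMaximal (m : Ideal R) [hm : m.IsMaximal] : Ring.jacobson R ≤ m :=
  sInf_le hm.out

/-- A map from S = R/m is determined by the image of a generator, an element killed by m and
therefore lying in R / rad R. Projecting on to R/m loses nothing, because R / rad R is reduced. -/
theorem length_hom_le_one_of_isSimpleModule {E : Type u} [AddCommGroup E] [Module R E]
    {i : (R ⧸ Ring.jacobson R) →ₗ[R] E} (h : IsInjectiveEnvelope i)
    (S : Type*) [AddCommGroup S] [Module R S] [IsSimpleModule R S] :
    Module.length R (S →ₗ[R] E) ≤ 1 := by
  have := IsSimpleModule.nontrivial R S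
  obtain ⟨s, hs⟩ := exists_ne (0 : S)
  set m : Ideal R := LinearMap.ker (LinearMap.toSpanSingleton R S s) with hmdef
  have hm : m.IsMaximal := IsSimpleModule.ker_toSpanSingleton_isMaximal R hs
  have hms : ∀ r ∈ m, r • s = 0 := fun r hr => by simpa [hmdef] using hr
  have hkill : ∀ (f : S →ₗ[R] E), ∀ r ∈ m, r • f s = 0 := fun f r hr => by
    rw [← map_smul, hms r hr, map_zero]
  let ev : (S →ₗ[R] E) →ₗ[R] LinearMap.range i :=
    (LinearMap.applyₗ s).codRestrict _ fun f =>
      h.mem_range_of_smul_eq_zero m (hkill f)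
  let g : (S →ₗ[R] E) →ₗ[R] R ⧸ Ring.jacobson R :=
    (LinearEquiv.ofInjective i h.injective_map).symm.toLinearMap ∘ₗ ev
  have hg : ∀ f, i (g f) = f s := fun f =>
    congrArg Subtype.val ((LinearEquiv.ofInjective i h.injective_map).apply_symm_apply (ev f))
  let p : (S →ₗ[R] E) →ₗ[R] R ⧸ m :=
    Submodule.factor (jacobson_le_of_isMaximal m) ∘ₗ g
  have hp : Function.Injective p := by
    rw [← LinearMap.ker_eq_bot, eq_bot_iff]
    intro f hf
    obtain ⟨r, hr⟩ := Submodule.mkQ_surjective _ (g f)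
    have hrm : r ∈ m := by
      have h1 : p f = 0 := hf
      have h2 : p f = Submodule.mkQ m r := by
        change Submodule.factor (jacobson_le_of_isMaximal m) (g f) = _
        rw [← hr]
        rfl
      rw [h2] at h1
      exact (Submodule.Quotient.mk_eq_zero m).1 h1
    -- The class of r is `g f`, which is killed by m, and r itself lies in m.
    have hrr : r * r ∈ Ring.jacobson R := by
      rw [← Submodule.Quotient.mk_eq_zero (Ring.jacobson R)]
      apply h.injective_map
      change i (r • Submodule.mkQ _ r) = _
      rw [hr, map_smul, hg, hkill f r hrm, map_zero]
    have hg0 : g f = 0 := by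
      rw [← hr]
      exact (Submodule.Quotient.mk_eq_zero _).2 (mem_jacobson_of_mul_self_mem hrr)
    have hfs : f s = 0 := by rw [← hg, hg0, map_zero]
    rw [Submodule.mem_bot]
    ext x
    obtain ⟨r, rfl⟩ := IsSimpleModule.toSpanSingleton_surjective R hs x
    simp [hfs]
  calc _ ≤ Module.length R (R ⧸ m) := Module.length_le_of_injective p hp
    _ = 1 := by
      have : IsSimpleModule R (R ⧸ m) := isSimpleModule_iff_isCoatom.2 hm.out
      exact Module.length_eq_one R _

/-- Induction along a composition series, using only left exactness of Hom(-, E). The inequality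
suffices for everything below. -/
theorem length_hom_le {E : Type u} [AddCommGroup E] [Module R E]
    {i : (R ⧸ Ring.jacobson R) →ₗ[R] E} (h : IsInjectiveEnvelope i)
    {M : Type*} [AddCommGroup M] [Module R M] (hM : IsFiniteLength R M) :
    Module.length R (M →ₗ[R] E) ≤ Module.length R M := by
  induction hM with
  | of_subsingleton =>
    rw [Module.length_eq_zero]
    exact zero_le
  | @of_simple_quotient M _ _ N _ _ ih =>
    let a : ((M ⧸ N) →ₗ[R] E) →ₗ[R] (M →ₗ[R] E) := LinearMap.lcomp R E N.mkQ
    let b : (M →ₗ[R] E) →ₗ[R] (N →ₗ[R] E) := LinearMap.lcomp R E N.subtype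
    have ha : Function.Injective a := fun f g hfg => by
      ext x
      exact LinearMap.congr_fun hfg x
    have hab : Function.Exact a b.rangeRestrict := by
      intro f
      constructor
      · intro hf
        have hf' : b f = 0 := congrArg Subtype.val hf
        exact ⟨N.liftQ f fun x hx => LinearMap.congr_fun hf' ⟨x, hx⟩, by ext; rfl⟩
      · rintro ⟨g, rfl⟩
        apply Subtype.ext
        ext x
        change g (N.mkQ x) = 0
        rw [show N.mkQ x = 0 from (Submodule.Quotient.mk_eq_zero N).2 x.2, map_zero]
    rw [Module.length_eq_add_of_exact a b.rangeRestrict ha b.surjective_rangeRestrict hab,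
      Module.length_eq_add_of_exact N.subtype N.mkQ N.injective_subtype N.mkQ_surjective
        (LinearMap.exact_subtype_mkQ N), Module.length_eq_one R (M ⧸ N), add_comm]
    exact add_le_add ((Module.length_le_of_injective _ (Submodule.injective_subtype _)).trans ih)
      (length_hom_le_one_of_isSimpleModule h _)

theorem isFiniteLength_hom {E : Type u} [AddCommGroup E] [Module R E]
    {i : (R ⧸ Ring.jacobson R) →ₗ[R] E} (h : IsInjectiveEnvelope i)
    {M : Type*} [AddCommGroup M] [Module R M] (hM : IsFiniteLength R M) :
    IsFiniteLength R (M →ₗ[R] E) :=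
  Module.length_ne_top_iff.1
    (ne_top_of_le_ne_top (Module.length_ne_top_iff.2 hM) (length_hom_le h hM))

/-- A submodule of `Hom(N, E)` contains every map that vanishes on its common kernel. -/
theorem mem_of_vanishes_on_annihilator {E : Type u} [AddCommGroup E] [Module R E]
    {i : (R ⧸ Ring.jacobson R) →ₗ[R] E} (h : IsInjectiveEnvelope i)
    {N : Type*} [AddCommGroup N] [Module R N] (hN : IsFiniteLength R N)
    (X : Submodule R (N →ₗ[R] E)) (f : N →ₗ[R] E)
    (hf : ∀ n : N, (∀ g ∈ X, g n = 0) → f n = 0) : f ∈ X := by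
  let K : Submodule R N := LinearMap.ker (X.subtype.flip)
  have hK : ∀ n, n ∈ K ↔ ∀ g ∈ X, g n = 0 := fun n =>
    ⟨fun hn g hg => LinearMap.congr_fun (LinearMap.mem_ker.1 hn) ⟨g, hg⟩,
      fun hn => LinearMap.mem_ker.2 (LinearMap.ext fun g => hn g g.2)⟩
  let a : ((N ⧸ K) →ₗ[R] E) →ₗ[R] (N →ₗ[R] E) := LinearMap.lcomp R E K.mkQ
  have ha : Function.Injective a := fun f g hfg => by
    ext x
    exact LinearMap.congr_fun hfg x
  have hHom : IsFiniteLength R (N →ₗ[R] E) := isFiniteLength_hom h hN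
  obtain ⟨_, _⟩ := isFiniteLength_iff_isNoetherian_isArtinian.1 hHom
  obtain ⟨_, _⟩ := isFiniteLength_iff_isNoetherian_isArtinian.1 hN
  have hX : IsFiniteLength R X := isFiniteLength_iff_isNoetherian_isArtinian.2 ⟨inferInstance,
    inferInstance⟩
  have hQ : IsFiniteLength R (N ⧸ K) := isFiniteLength_iff_isNoetherian_isArtinian.2
    ⟨inferInstance, inferInstance⟩
  have hle : X ≤ LinearMap.range a := fun g hg =>
    ⟨K.liftQ g fun n hn => (hK n).1 hn g hg, by ext; rfl⟩
  -- X sits inside Hom(N/K, E), while N/K embeds into Hom(X, E). Two uses of the length bound give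
  -- ℓ(Hom(N/K, E)) ≤ ℓ(N/K) ≤ ℓ(Hom(X, E)) ≤ ℓ(X), so X is all of Hom(N/K, E).
  have hlen : Module.length R (LinearMap.range a) ≤ Module.length R X := by
    rw [← (LinearEquiv.ofInjective a ha).length_eq]
    refine (length_hom_le h hQ).trans (le_trans ?_ (length_hom_le h hX))
    exact Module.length_le_of_injective (K.liftQ X.subtype.flip le_rfl)
      (LinearMap.ker_eq_bot.1 (Submodule.ker_liftQ_eq_bot' _ _ rfl))
  have htop : X.comap (LinearMap.range a).subtype = ⊤ := by
    by_contra hne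
    have := Submodule.length_lt hne
    rw [(Submodule.comapSubtypeEquivOfLe hle).length_eq] at this
    exact absurd hlen (not_le.2 this)
  have hfa : f ∈ LinearMap.range a :=
    ⟨K.liftQ f fun n hn => hf n ((hK n).1 hn), by ext; rfl⟩
  have : (⟨f, hfa⟩ : LinearMap.range a) ∈ X.comap (LinearMap.range a).subtype := by
    rw [htop]
    trivial
  exact this

/-- E is a cogenerator: the cyclic module Rn has a simple quotient R/m, which embeds in the
semisimple ring R / rad R and so in E; injectivity of E extends the resulting map to M. -/
theorem exists_hom_apply_ne_zero [IsArtinianRing R] {E : Type u} [AddCommGroup E] [Module R E]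
    {i : (R ⧸ Ring.jacobson R) →ₗ[R] E} (h : IsInjectiveEnvelope i)
    {M : Type u} [AddCommGroup M] [Module R M] {n : M} (hn : n ≠ 0) :
    ∃ f : M →ₗ[R] E, f n ≠ 0 := by
  set K : Ideal R := LinearMap.ker (LinearMap.toSpanSingleton R M n) with hKdef
  have hK : K ≠ ⊤ := by
    rw [Ne, Ideal.eq_top_iff_one, hKdef]
    simpa using hn
  obtain ⟨m, hm, hKm⟩ := Ideal.exists_le_maximal K hK
  obtain ⟨y, hy0, hy⟩ : ∃ y : R ⧸ Ring.jacobson R, y ≠ 0 ∧ ∀ r ∈ m, r • y = 0 := by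
    let m' : Ideal (R ⧸ Ring.jacobson R) := m.map (Ideal.Quotient.mk _)
    have hm' : m' ≠ ⊤ := fun htop => hm.ne_top (by
      rw [← sup_eq_right.2 (jacobson_le_of_isMaximal m), ← Ideal.comap_map_quotientMk]
      exact congrArg _ htop)
    -- A complement of m / rad R in the semisimple ring R / rad R is a nonzero ideal killed by m.
    obtain ⟨C, hC⟩ := exists_isCompl m'
    have hC0 : C ≠ ⊥ := fun h0 => hm' (by simpa [h0] using hC.sup_eq_top)
    obtain ⟨y, hyC, hy0⟩ := Submodule.exists_mem_ne_zero_of_ne_bot hC0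
    refine ⟨y, hy0, fun r hr => ?_⟩
    have h1 : Ideal.Quotient.mk _ r * y ∈ m' ⊓ C :=
      ⟨Ideal.mul_mem_right _ _ (Ideal.mem_map_of_mem _ hr), Ideal.mul_mem_left _ _ hyC⟩
    rw [hC.inf_eq_bot] at h1
    exact h1
  let g : R ⧸ K →ₗ[R] E := K.liftQ (i ∘ₗ LinearMap.toSpanSingleton R _ y) fun r hr => by
    simp [hy r (hKm hr)]
  obtain ⟨f, hf⟩ := h.injective_module.out (K.liftQ (LinearMap.toSpanSingleton R M n) le_rfl)
    (LinearMap.ker_eq_bot.1 (Submodule.ker_liftQ_eq_bot' _ _ rfl)) g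
  refine ⟨f, fun h0 => hy0 (h.injective_map ?_)⟩
  have h1 := hf (K.mkQ 1)
  have h2 : K.liftQ (LinearMap.toSpanSingleton R M n) le_rfl (K.mkQ 1) = n :=
    one_smul R n
  have h3 : g (K.mkQ 1) = i y :=
    congrArg i (one_smul R y)
  rw [h2, h3, h0] at h1
  rw [← h1, map_zero]

end Matlis

/-! ## Indecomposable modules -/

section Indecomposable

variable {B : Type*} [Ring B]

/-- The only idempotent endomorphisms of `M` are `0` and `1`. -/
def TrivialIdempotents (B : Type*) [Ring B] (M : Type*) [AddCommGroup M] [Module B M] : Prop :=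
  ∀ p : Module.End B M, IsIdempotentElem p → p = 0 ∨ p = 1

/-- Decompositions into two summands correspond to idempotent endomorphisms, by taking range and
kernel. -/
theorem indecomposable_iff {B : Type u} [Ring B] (M : ModuleCat.{u} B) :
    Indecomposable M ↔ Nontrivial M ∧ TrivialIdempotents B M := by
  constructor
  · rintro ⟨h0, h⟩
    refine ⟨not_subsingleton_iff_nontrivial.1 fun hs => h0 (ModuleCat.isZero_of_subsingleton M),
      fun p hp => ?_⟩
    have hc := LinearMap.IsIdempotentElem.isCompl hp
    let a : M ≅ ModuleCat.of B (LinearMap.range p) ⊞ ModuleCat.of B (LinearMap.ker p) :=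
      (Submodule.prodEquivOfIsCompl _ _ hc).symm.toModuleIso ≪≫
        (ModuleCat.biprodIsoProd (ModuleCat.of B (LinearMap.range p))
          (ModuleCat.of B (LinearMap.ker p))).symm
    rcases h _ _ a with h1 | h1
    · left
      have := ModuleCat.subsingleton_of_isZero h1
      ext x
      exact congrArg Subtype.val (Subsingleton.elim (⟨p x, x, rfl⟩ : LinearMap.range p) 0)
    · right
      have := ModuleCat.subsingleton_of_isZero h1
      ext x
      have hx : x - p x ∈ LinearMap.ker p := by
        rw [LinearMap.mem_ker, map_sub, sub_eq_zero]
        exact (LinearMap.congr_fun hp x).symm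
      have := congrArg Subtype.val (Subsingleton.elim (⟨x - p x, hx⟩ : LinearMap.ker p) 0)
      exact (sub_eq_zero.1 this).symm
  · rintro ⟨h0, h⟩
    refine ⟨fun hz => not_subsingleton M (ModuleCat.subsingleton_of_isZero hz), fun Y Z a => ?_⟩
    let q : M ⟶ M := a.hom ≫ Limits.biprod.fst ≫ Limits.biprod.inl ≫ a.inv
    have hq : q ≫ q = q := by simp [q]
    rcases h q.hom (congrArg ModuleCat.Hom.hom hq) with h1 | h1
    · left
      have hq0 : q = 0 := ModuleCat.hom_ext h1
      rw [Limits.IsZero.iff_id_eq_zero]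
      calc 𝟙 Y = Limits.biprod.inl ≫ a.inv ≫ q ≫ a.hom ≫ Limits.biprod.fst := by simp [q]
        _ = 0 := by simp [hq0]
    · right
      have hq1 : q = 𝟙 M := ModuleCat.hom_ext h1
      rw [Limits.IsZero.iff_id_eq_zero]
      calc 𝟙 Z = Limits.biprod.inr ≫ a.inv ≫ 𝟙 M ≫ a.hom ≫ Limits.biprod.snd := by simp
        _ = 0 := by rw [← hq1]; simp [q]

variable {M : Type*} [AddCommGroup M] [Module B M]

theorem isLocalRing_end [Nontrivial M] [IsNoetherian B M] [IsArtinian B M]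
    (hM : TrivialIdempotents B M) : IsLocalRing (Module.End B M) := by
  have key : ∀ f : Module.End B M, IsUnit f ∨ IsNilpotent f := by
    intro f
    -- Fitting's lemma: M is the direct sum of the kernel and range of a high power of f. The
    -- exponent is kept positive so that a unit f ^ n makes f a unit.
    obtain ⟨n, hn⟩ := (f.eventually_isCompl_ker_pow_range_pow.and
      (Filter.eventually_ge_atTop 1)).exists
    obtain ⟨hc, hn1⟩ := hn
    rcases hM _ (Submodule.isIdempotentElem_projection hc) with h | h
    · left
      have hker : LinearMap.ker (f ^ n) = ⊥ := by
        rw [← Submodule.range_projection hc, h, LinearMap.range_zero]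
      have hrange : LinearMap.range (f ^ n) = ⊤ := by simpa [hker] using hc.sup_eq_top
      have : IsUnit (f ^ n) := (Module.End.isUnit_iff _).2
        ⟨LinearMap.ker_eq_bot.1 hker, LinearMap.range_eq_top.1 hrange⟩
      exact (isUnit_pow_iff (by lia)).1 this
    · right
      have hker : LinearMap.ker (f ^ n) = ⊤ := by
        rw [← Submodule.range_projection hc, h]
        exact LinearMap.range_id
      exact ⟨n, LinearMap.ker_eq_top.1 hker⟩
  exact IsLocalRing.of_isUnit_or_isUnit_one_sub_self fun f =>
    (key f).imp_right fun hf => hf.isUnit_one_sub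

/-- An indecomposable retract of a finite direct sum of indecomposable modules is isomorphic to
one of them. -/
theorem exists_linearEquiv_of_retract [Nontrivial M] [IsNoetherian B M] [IsArtinian B M]
    (hM : TrivialIdempotents B M) {κ : Type*} [Fintype κ] (X : κ → Type*)
    [∀ k, AddCommGroup (X k)] [∀ k, Module B (X k)] (hX : ∀ k, TrivialIdempotents B (X k))
    (s : M →ₗ[B] (k : κ) → X k) (r : ((k : κ) → X k) →ₗ[B] M) (hrs : ∀ m, r (s m) = m) :
    ∃ k, Nonempty (M ≃ₗ[B] X k) := by
  classical
  have := isLocalRing_end hM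
  let a : κ → Module.End B M := fun k =>
    (r ∘ₗ LinearMap.single B X k) ∘ₗ (LinearMap.proj k ∘ₗ s)
  have ha : ∑ k, a k = 1 := by
    ext m
    simp only [a, LinearMap.sum_apply, LinearMap.comp_apply, Module.End.one_apply]
    rw [← map_sum]
    conv_rhs => rw [← hrs m]
    congr 1
    exact Finset.univ_sum_single (s m)
  -- The endomorphisms of M through the single X k sum to 1 in a local ring, so one is invertible.
  -- Then M is a nonzero retract of that X k, and the idempotent of the retraction must be 1.
  obtain ⟨k, -, hk⟩ : ∃ k ∈ Finset.univ, IsUnit (a k) :=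
    IsLocalRing.exists_of_isUnit_sum (by rw [ha]; exact isUnit_one)
  obtain ⟨b, hb⟩ := hk.exists_left_inv
  let σ : M →ₗ[B] X k := LinearMap.proj k ∘ₗ s
  let τ : X k →ₗ[B] M := b ∘ₗ (r ∘ₗ LinearMap.single B X k)
  have hτσ : ∀ m, τ (σ m) = m := fun m => LinearMap.congr_fun hb m
  have hid : IsIdempotentElem (σ ∘ₗ τ : Module.End B (X k)) := by
    ext x
    change σ (τ (σ (τ x))) = σ (τ x)
    rw [hτσ]
  refine ⟨k, ?_⟩
  rcases hX k _ hid with h | h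
  · exfalso
    obtain ⟨m, hm⟩ := exists_ne (0 : M)
    apply hm
    have : σ (τ (σ m)) = 0 := LinearMap.congr_fun h (σ m)
    rw [← hτσ m, ← hτσ (τ (σ m)), this, map_zero]
  · exact ⟨LinearEquiv.ofLinearMap σ τ h (LinearMap.ext hτσ)⟩

end Indecomposable

/-! ### Duality and the modules P_x and I_x over an artin algebra. -/

section ArtinAlgebra

variable (R : Type u) {A : Type u} [CommRing R] [Ring A] [Algebra R A]

theorem isNoetherianRing_mulOpposite (A : Type u) [Ring A] [Algebra R A] [IsArtinianRing R]
    [Module.Finite R A] : IsNoetherianRing Aᵐᵒᵖ :=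
  have : Module.Finite R Aᵐᵒᵖ := Module.Finite.equiv (MulOpposite.opLinearEquiv R)
  IsNoetherianRing.of_finite R Aᵐᵒᵖ

theorem isArtinianRing_mulOpposite (A : Type u) [Ring A] [Algebra R A] [IsArtinianRing R]
    [Module.Finite R A] : IsArtinianRing Aᵐᵒᵖ :=
  have : Module.Finite R Aᵐᵒᵖ := Module.Finite.equiv (MulOpposite.opLinearEquiv R)
  IsArtinianRing.of_finite R Aᵐᵒᵖ

/-! ### The module structure of the dual -/

section StdDual

variable (N : Type u) [AddCommGroup N] [Module R N] [Module A N] [IsScalarTower R A N]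

noncomputable instance : Module R (StdDual R N) :=
  inferInstanceAs (Module R (N →ₗ[R] dualizingModule R))

instance : IsScalarTower R Aᵐᵒᵖ (StdDual R N) where
  smul_assoc r a f := DFunLike.ext _ _ fun n => by
    change f ((r • a.unop) • n) = r • f (a.unop • n)
    rw [smul_assoc, map_smul]

variable {R N} in
theorem StdDual.exists_apply_ne_zero [IsArtinianRing R] {n : N} (hn : n ≠ 0) :
    ∃ f : StdDual R N, f n ≠ 0 :=
  have ⟨_, hi⟩ := injectiveEnvelope_spec (R := R) (R ⧸ Ring.jacobson R)
  exists_hom_apply_ne_zero hi hn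

theorem StdDual.moduleFinite [IsArtinianRing R] [Module.Finite R N] :
    Module.Finite Aᵐᵒᵖ (StdDual R N) := by
  obtain ⟨_, hi⟩ := injectiveEnvelope_spec (R := R) (R ⧸ Ring.jacobson R)
  have h : IsFiniteLength R (N →ₗ[R] dualizingModule R) := isFiniteLength_hom hi
    (isFiniteLength_iff_isNoetherian_isArtinian.2 ⟨inferInstance, inferInstance⟩)
  have : IsNoetherian R (StdDual R N) := (isFiniteLength_iff_isNoetherian_isArtinian.1 h).1
  have : IsNoetherian Aᵐᵒᵖ (StdDual R N) := isNoetherian_of_tower R this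
  infer_instance

variable {N} {N' : Type u} [AddCommGroup N'] [Module R N'] [Module A N'] [IsScalarTower R A N']

/-- The dual of a homomorphism. -/
noncomputable def StdDual.map (g : N →ₗ[A] N') : StdDual R N' →ₗ[Aᵐᵒᵖ] StdDual R N where
  toFun f := LinearMap.comp f (g.restrictScalars R)
  map_add' _ _ := rfl
  map_smul' a f := DFunLike.ext _ _ fun n => congrArg f (map_smul g a.unop n).symm

theorem StdDual.map_apply (g : N →ₗ[A] N') (f : StdDual R N') (n : N) :
    StdDual.map R g f n = f (g n) := rfl

theorem StdDual.sum_apply {κ : Type*} (s : Finset κ) (f : κ → StdDual R N) (n : N) :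
    (∑ k ∈ s, f k) n = ∑ k ∈ s, f k n :=
  LinearMap.sum_apply (M₂ := dualizingModule R) s f n

/-- If `D N = X ⊕ Y` then `N` is the direct sum of the annihilators of `X` and `Y`. -/
theorem StdDual.exists_isCompl [IsArtinianRing R] [Module.Finite R N]
    {p : Module.End Aᵐᵒᵖ (StdDual R N)} (hp : IsIdempotentElem p) :
    ∃ U V : Submodule A N, IsCompl U V ∧ (∀ n, n ∈ U ↔ ∀ f, p f n = 0) ∧
      ∀ n, n ∈ V ↔ ∀ f, p f n = f n := by
  have hp' : ∀ f, p (p f) = p f := LinearMap.congr_fun hp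
  obtain ⟨_, hi⟩ := injectiveEnvelope_spec (R := R) (R ⧸ Ring.jacobson R)
  have hN : IsFiniteLength R N :=
    isFiniteLength_iff_isNoetherian_isArtinian.2 ⟨inferInstance, inferInstance⟩
  let U : Submodule A N :=
    { carrier := {n | ∀ f, p f n = 0}
      add_mem' := fun {m n} hm hn f => by rw [map_add, hm, hn, add_zero]
      zero_mem' := fun f => map_zero _
      smul_mem' := fun a n hn f => by
        rw [← StdDual.op_smul_apply, ← map_smul]
        exact hn _ }
  let V : Submodule A N :=
    { carrier := {n | ∀ f, p f n = f n}
      add_mem' := fun {m n} hm hn f => by rw [map_add, hm, hn, map_add]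
      zero_mem' := fun f => by rw [map_zero, map_zero]
      smul_mem' := fun a n hn f => by
        rw [← StdDual.op_smul_apply, ← map_smul, ← StdDual.op_smul_apply]
        exact hn _ }
  refine ⟨U, V, ⟨disjoint_iff.2 ?_, codisjoint_iff.2 ?_⟩, fun _ => Iff.rfl, fun _ => Iff.rfl⟩
  · rw [eq_bot_iff]
    rintro n ⟨h1, h2⟩
    by_contra hn
    obtain ⟨f, hf⟩ := StdDual.exists_apply_ne_zero (R := R) (n := n) hn
    exact hf ((h2 f).symm.trans (h1 f))
  -- A nonzero functional vanishing on U + V would, by the double annihilator property, lie both in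
  -- the range and in the kernel of p.
  · by_contra hne
    obtain ⟨n, -, hn⟩ := SetLike.exists_of_lt (lt_top_iff_ne_top.2 hne)
    have hn' : (U ⊔ V).mkQ n ≠ 0 := fun h => hn ((Submodule.Quotient.mk_eq_zero _).1 h)
    obtain ⟨g, hg⟩ := StdDual.exists_apply_ne_zero (R := R) hn'
    let f : StdDual R N := StdDual.map R (U ⊔ V).mkQ g
    have hf0 : ∀ m ∈ U ⊔ V, f m = 0 := fun m hm => by
      rw [StdDual.map_apply, show (U ⊔ V).mkQ m = 0 from (Submodule.Quotient.mk_eq_zero _).2 hm,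
        map_zero]
    have h1 : f ∈ LinearMap.range (p.restrictScalars R) :=
      mem_of_vanishes_on_annihilator hi hN (LinearMap.range (p.restrictScalars R)) f
        fun m hm => hf0 m (Submodule.mem_sup_left fun f' => hm _ ⟨f', rfl⟩)
    have h2 : f ∈ LinearMap.ker (p.restrictScalars R) :=
      mem_of_vanishes_on_annihilator hi hN (LinearMap.ker (p.restrictScalars R)) f
        fun m hm => hf0 m (Submodule.mem_sup_right fun f' => by
          have : (f' - p f') ∈ LinearMap.ker (p.restrictScalars R) := by
            rw [LinearMap.mem_ker]
            change p (f' - p f') = 0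
            rw [map_sub, hp', sub_self]
          have := hm _ this
          exact (sub_eq_zero.1 this).symm)
    obtain ⟨f', hf'⟩ := h1
    have hfz : f = 0 := by
      have h3 : p f = 0 := h2
      have h4 : p f' = f := hf'
      rw [← h4, ← hp', h4, h3]
    exact hg (DFunLike.congr_fun hfz n)

end StdDual

/-! ### The projective and injective modules of an idempotent -/

/-- The idempotent `e` is not the sum of two nonzero orthogonal idempotents. -/
def IsPrimitive (e : A) : Prop :=
  ∀ f g : A, IsIdempotentElem f → IsIdempotentElem g → f * g = 0 → g * f = 0 →
    f + g = e → f = 0 ∨ g = 0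

theorem mul_eq_of_mem_span {e : A} (he : IsIdempotentElem e) {n : A}
    (hn : n ∈ Submodule.span A {e}) : n * e = n := by
  obtain ⟨a, rfl⟩ := Submodule.mem_span_singleton.1 hn
  rw [smul_eq_mul, mul_assoc, he.eq]

/-- The generator of `eA`. -/
def projModule.gen (e : A) : projModule e := ⟨e, Submodule.mem_span_singleton_self e⟩

theorem projModule.eq_smul_gen {e : A} (he : IsIdempotentElem e) (x : projModule e) :
    x = MulOpposite.op (x : A) • projModule.gen e :=
  Subtype.ext ((mem_projModule_iff he _).1 x.2).symm

theorem projModule.nontrivial {e : A} (he : e ≠ 0) : Nontrivial (projModule e) :=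
  ⟨gen e, 0, fun h => he (congrArg Subtype.val h)⟩

/-- An endomorphism of eA is left multiplication by the image f of e; if it is idempotent, e = f +
(e - f) is an orthogonal decomposition. -/
theorem projModule.trivialIdempotents {e : A} (he : IsIdempotentElem e) (hprim : IsPrimitive e) :
    TrivialIdempotents Aᵐᵒᵖ (projModule e) := by
  intro p hp
  set f : A := (p (gen e) : A) with hf
  have hpx : ∀ x : projModule e, (p x : A) = f * x := fun x => by
    conv_lhs => rw [eq_smul_gen he x, map_smul]
    rfl
  have hef : e * f = f := (mem_projModule_iff he _).1 (p (gen e)).2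
  have hfe : f * e = f := (hpx (gen e)).symm
  have hff : f * f = f := by
    rw [← hpx]
    exact congrArg Subtype.val (LinearMap.congr_fun hp (gen e))
  have hidem : IsIdempotentElem (e - f) := by
    simp [IsIdempotentElem, mul_sub, sub_mul, he.eq, hef, hfe, hff]
  rcases hprim f (e - f) hff hidem (by rw [mul_sub, hfe, hff, sub_self])
    (by rw [sub_mul, hef, hff, sub_self]) (add_sub_cancel _ _) with h | h
  · left
    ext x
    rw [hpx, h, zero_mul]
    rfl
  · right
    ext x
    rw [hpx, ← sub_eq_zero.1 h]
    exact (mem_projModule_iff he _).1 x.2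

theorem injModule.nontrivial [IsArtinianRing R] {e : A} (he : e ≠ 0) :
    Nontrivial (injModule R e) := by
  obtain ⟨f, hf⟩ := StdDual.exists_apply_ne_zero (R := R) (N := Submodule.span A {e})
    (n := ⟨e, Submodule.mem_span_singleton_self e⟩) fun h => he (congrArg Subtype.val h)
  exact ⟨f, 0, fun h => hf (DFunLike.congr_fun h _)⟩

theorem injModule.moduleFinite [IsArtinianRing R] [Module.Finite R A] (e : A) :
    Module.Finite Aᵐᵒᵖ (injModule R e) :=
  have : Module.Finite R (Submodule.span A {e}) :=
    Module.Finite.of_injective ((Submodule.span A {e}).subtype.restrictScalars R)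
      Subtype.val_injective
  StdDual.moduleFinite R _

/-- An idempotent on D(Ae) splits Ae as U ⊕ V. The components u, v of the generator e are orthogonal
idempotents, so one vanishes and Ae equals U or V. -/
theorem injModule.trivialIdempotents [IsArtinianRing R] [Module.Finite R A] {e : A}
    (he : IsIdempotentElem e) (hprim : IsPrimitive e) :
    TrivialIdempotents Aᵐᵒᵖ (injModule R e) := by
  intro p hp
  have : Module.Finite R (Submodule.span A {e}) :=
    Module.Finite.of_injective ((Submodule.span A {e}).subtype.restrictScalars R)
      Subtype.val_injective
  obtain ⟨U, V, hUV, hU, hV⟩ := StdDual.exists_isCompl R hp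
  let g : Submodule.span A {e} := ⟨e, Submodule.mem_span_singleton_self e⟩
  have hgen : ∀ n : Submodule.span A {e}, n = (n : A) • g := fun n =>
    Subtype.ext (mul_eq_of_mem_span he n.2).symm
  obtain ⟨u, hu, v, hv, huv⟩ := Submodule.mem_sup.1 (hUV.sup_eq_top.ge (Submodule.mem_top (x := g)))
  have huv' : (u : A) + v = e := congrArg Subtype.val huv
  have hdisj : ∀ z : Submodule.span A {e}, z ∈ U → z ∈ V → (z : A) = 0 := fun z h1 h2 =>
    congrArg Subtype.val ((Submodule.mem_bot A).1 (hUV.inf_eq_bot.le ⟨h1, h2⟩))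
  -- Since u = ue = uu + uv, the product uv lies in U as u - uu and in V as a multiple of v, hence
  -- is zero.
  have hu_mul : (u : A) - u * u = u * v := by
    rw [sub_eq_iff_eq_add, ← mul_add, add_comm (v : A), huv', mul_eq_of_mem_span he u.2]
  have hv_mul : (v : A) - v * v = v * u := by
    rw [sub_eq_iff_eq_add, ← mul_add, huv', mul_eq_of_mem_span he v.2]
  have h1 : (u : A) * v = 0 := hdisj ((u : A) • v)
    (by
      have : (u : A) • v = u - (u : A) • u := Subtype.ext hu_mul.symm
      rw [this]
      exact sub_mem hu (Submodule.smul_mem _ _ hu)) (Submodule.smul_mem _ _ hv)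
  have h2 : (v : A) * u = 0 := hdisj ((v : A) • u) (Submodule.smul_mem _ _ hu)
    (by
      have : (v : A) • u = v - (v : A) • v := Subtype.ext hv_mul.symm
      rw [this]
      exact sub_mem hv (Submodule.smul_mem _ _ hv))
  rcases hprim u v (sub_eq_zero.1 (hu_mul.trans h1)).symm (sub_eq_zero.1 (hv_mul.trans h2)).symm
    h1 h2 huv' with h | h
  · right
    have hg : g ∈ V := by
      rw [← huv, show u = 0 from Subtype.ext h, zero_add]
      exact hv
    exact LinearMap.ext fun f => DFunLike.ext _ _ fun n =>
      (hV n).1 (hgen n ▸ Submodule.smul_mem _ _ hg) f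
  · left
    have hg : g ∈ U := by
      rw [← huv, show v = 0 from Subtype.ext h, add_zero]
      exact hu
    exact LinearMap.ext fun f => DFunLike.ext _ _ fun n =>
      (hU n).1 (hgen n ▸ Submodule.smul_mem _ _ hg) f

/-- The retraction `a ↦ ea` of `A` onto `eA`. -/
def projRetraction (e : A) : A →ₗ[Aᵐᵒᵖ] projModule e where
  toFun a := ⟨e * a, Submodule.mem_span_singleton.2 ⟨MulOpposite.op a, rfl⟩⟩
  map_add' a b := Subtype.ext (mul_add e a b)
  map_smul' a b := Subtype.ext (mul_assoc e b a.unop).symm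

/-- The retraction `a ↦ ae` of `A` onto `Ae`. -/
def leftRetraction (e : A) : A →ₗ[A] Submodule.span A {e} :=
  (LinearMap.toSpanSingleton A A e).codRestrict _
    fun a => Submodule.smul_mem _ a (Submodule.mem_span_singleton_self e)

/-- The embedding of `D(Ae)` into `DA`. -/
noncomputable def injInclusion (e : A) : injModule R e →ₗ[Aᵐᵒᵖ] StdDual R A :=
  StdDual.map R (leftRetraction e)

/-- The restriction of `DA` onto `D(Ae)`. -/
noncomputable def injRestriction (e : A) : StdDual R A →ₗ[Aᵐᵒᵖ] injModule R e :=
  StdDual.map R (Submodule.span A {e}).subtype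

theorem injRestriction_injInclusion {e : A} (he : IsIdempotentElem e) (f : injModule R e) :
    injRestriction R e (injInclusion R e f) = f :=
  DFunLike.ext _ _ fun n => congrArg f (Subtype.ext (mul_eq_of_mem_span he n.2))

theorem projRetraction_subtype {e : A} (he : IsIdempotentElem e) (x : projModule e) :
    projRetraction e x = x :=
  Subtype.ext ((mem_projModule_iff he _).1 x.2)

/-- A module with a complete system of orthogonal retracts is their direct sum. -/
def equivPiOfRetracts {B : Type*} [Ring B] {κ : Type*} [Fintype κ] [DecidableEq κ] {M : Type*}
    [AddCommGroup M] [Module B M] {X : κ → Type*} [∀ k, AddCommGroup (X k)] [∀ k, Module B (X k)]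
    (s : ∀ k, X k →ₗ[B] M) (r : ∀ k, M →ₗ[B] X k) (hsum : ∀ m, ∑ k, s k (r k m) = m)
    (hself : ∀ k x, r k (s k x) = x) (hne : ∀ k l x, k ≠ l → r k (s l x) = 0) :
    M ≃ₗ[B] ((k : κ) → X k) :=
  LinearEquiv.ofLinearMap (LinearMap.pi r) (∑ k, s k ∘ₗ LinearMap.proj k)
    (by
      refine LinearMap.ext fun x => funext fun k => ?_
      simp only [LinearMap.comp_apply, LinearMap.pi_apply, LinearMap.sum_apply, map_sum,
        LinearMap.proj_apply, LinearMap.id_apply]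
      rw [Finset.sum_eq_single k (fun l _ hl => hne k l _ hl.symm) (by simp), hself])
    (by
      refine LinearMap.ext fun m => ?_
      simpa [LinearMap.sum_apply] using hsum m)

/-! ### Decomposition of A and DA along a complete system of idempotents. -/

section System

variable {ι : Type v} [Fintype ι] {e : ι → A}

theorem nonempty_equiv_pi_projModule (he : CompleteOrthogonalIdempotents e) :
    Nonempty (A ≃ₗ[Aᵐᵒᵖ] ((x : ι) → projModule (e x))) := by
  classical
  refine ⟨equivPiOfRetracts (fun x => (projModule (e x)).subtype) (fun x => projRetraction (e x))
    (fun a => ?_) (fun x => projRetraction_subtype (he.idem x)) fun x y p hxy => Subtype.ext ?_⟩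
  · change ∑ x, e x * a = a
    rw [← Finset.sum_mul, he.complete, one_mul]
  · change e x * (p : A) = 0
    rw [← (mem_projModule_iff (he.idem y) _).1 p.2, ← mul_assoc, he.ortho hxy, zero_mul]

theorem nonempty_equiv_pi_injModule (he : CompleteOrthogonalIdempotents e) :
    Nonempty (StdDual R A ≃ₗ[Aᵐᵒᵖ] ((x : ι) → injModule R (e x))) := by
  classical
  refine ⟨equivPiOfRetracts (fun x => injInclusion R (e x)) (fun x => injRestriction R (e x))
    (fun f => DFunLike.ext _ _ fun a => ?_)
    (fun x => injRestriction_injInclusion R (he.idem x)) fun x y f hxy =>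
      DFunLike.ext _ _ fun n => ?_⟩
  · rw [StdDual.sum_apply]
    change ∑ x, f (a * e x) = f a
    rw [← map_sum, ← Finset.mul_sum, he.complete, mul_one]
  · change f (leftRetraction (e y) n) = 0
    have : leftRetraction (e y) (n : A) = 0 := Subtype.ext (by
      change (n : A) * e y = 0
      rw [← mul_eq_of_mem_span (he.idem x) n.2, mul_assoc, he.ortho hxy, mul_zero])
    rw [this, map_zero]

end System

/-! ### Modules on which an idempotent acts nontrivially -/

variable {M : Type u} [AddCommGroup M] [Module Aᵐᵒᵖ M]

/-- The map p ↦ mp sends the generator e to me. -/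
theorem exists_projModule_hom_ne_zero {e : A} {m : M} (hm : MulOpposite.op e • m ≠ 0) :
    ∃ g : projModule e →ₗ[Aᵐᵒᵖ] M, g ≠ 0 := by
  let g : projModule e →ₗ[Aᵐᵒᵖ] M :=
    { toFun := fun p => MulOpposite.op (p : A) • m
      map_add' := fun p q => add_smul (MulOpposite.op (p : A)) (MulOpposite.op (q : A)) m
      map_smul' := fun a p => mul_smul a (MulOpposite.op (p : A)) m }
  exact ⟨g, fun h => hm (LinearMap.congr_fun h (projModule.gen e))⟩

/-- Choose an R-linear θ : M → E with θ(me) ≠ 0, and send x to the functional n ↦ θ(xn) on Ae. -/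
theorem exists_injModule_hom_ne_zero [IsArtinianRing R] {e : A} {m : M}
    (hm : MulOpposite.op e • m ≠ 0) : ∃ g : M →ₗ[Aᵐᵒᵖ] injModule R e, g ≠ 0 := by
  let _ : Module R M := Module.compHom M (algebraMap R Aᵐᵒᵖ)
  have hsmul : ∀ (r : R) (n : A) (x : M),
      MulOpposite.op (r • n) • x = r • MulOpposite.op n • x := fun r n x => by
    rw [MulOpposite.op_smul, Algebra.smul_def, mul_smul]
    rfl
  obtain ⟨_, hi⟩ := injectiveEnvelope_spec (R := R) (R ⧸ Ring.jacobson R)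
  obtain ⟨θ, hθ⟩ := exists_hom_apply_ne_zero hi hm
  let g₀ : M → (Submodule.span A {e} →ₗ[R] dualizingModule R) := fun x =>
    { toFun := fun n => θ (MulOpposite.op (n : A) • x)
      map_add' := fun n n' => by
        rw [Submodule.coe_add, MulOpposite.op_add, add_smul, map_add]
      map_smul' := fun r n => by
        rw [Submodule.coe_smul_of_tower, hsmul, map_smul]
        rfl }
  let g : M →ₗ[Aᵐᵒᵖ] injModule R e :=
    { toFun := g₀
      map_add' := fun x y => DFunLike.ext _ _ fun n => by
        change θ (_ • (x + y)) = θ _ + θ _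
        rw [smul_add, map_add]
      map_smul' := fun a x => DFunLike.ext _ _ fun n => by
        change θ (MulOpposite.op (n : A) • a • x) = θ (MulOpposite.op (a.unop * n) • x)
        rw [MulOpposite.op_mul, MulOpposite.op_unop, mul_smul] }
  exact ⟨g, fun h => hθ (DFunLike.congr_fun (LinearMap.congr_fun h m)
    ⟨e, Submodule.mem_span_singleton_self e⟩)⟩

theorem exists_smul_injModule_ne_zero [IsArtinianRing R] {e : A} (he : IsIdempotentElem e)
    (h0 : e ≠ 0) : ∃ f : injModule R e, MulOpposite.op e • f ≠ 0 := by
  let g : Submodule.span A {e} := ⟨e, Submodule.mem_span_singleton_self e⟩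
  obtain ⟨f, hf⟩ := StdDual.exists_apply_ne_zero (R := R) (n := g)
    fun h => h0 (congrArg Subtype.val h)
  refine ⟨f, fun h => hf ?_⟩
  have h1 : f (e • g) = 0 := DFunLike.congr_fun h g
  rwa [show e • g = g from Subtype.ext he.eq] at h1

end ArtinAlgebra

/-! ## Modules supported on a full subcategory -/

section Support

variable {A : Type u} [Ring A] {ι : Type v} [Fintype ι] {e : ι → A}

theorem supportIdempotent_mul_eq_zero (he : OrthogonalIdempotents e) {S : Set ι} {x : ι}
    (hx : x ∉ S) : supportIdempotent e S * e x = 0 := by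
  classical
  rw [supportIdempotent, Finset.sum_mul]
  refine Finset.sum_eq_zero fun y hy => he.ortho fun h => hx ?_
  subst h
  simpa using hy

theorem op_supportIdempotent_smul (he : CompleteOrthogonalIdempotents e) {S : Set ι}
    {M : Type*} [AddCommGroup M] [Module Aᵐᵒᵖ M]
    (h : ∀ x ∉ S, ∀ m : M, MulOpposite.op (e x) • m = 0) (m : M) :
    MulOpposite.op (supportIdempotent e S) • m = m := by
  classical
  conv_rhs => rw [← one_smul Aᵐᵒᵖ m, ← MulOpposite.op_one, ← he.complete]
  rw [supportIdempotent, Finset.op_sum, Finset.op_sum, Finset.sum_smul, Finset.sum_smul]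
  refine Finset.sum_subset (Finset.subset_univ _) fun x _ hx => h x (by simpa using hx) m

/-- If the e_x outside S kill M, then ε acts as the identity, so a and εaε act alike. Hence M has
the same submodules and endomorphisms over A and over εAε, and finite generation and
indecomposability carry over. -/
theorem mem_indFullSubcat_iff (he : CompleteOrthogonalIdempotents e) (S : Set ι) (M : Ind A) :
    M ∈ indFullSubcat he.toOrthogonalIdempotents S ↔
      ∀ x ∉ S, ∀ m : M.obj, MulOpposite.op (e x) • m = 0 := by
  constructor
  · rintro ⟨X, φ, hφ⟩ x hx m
    apply φ.injective
    have h0 : compress he.toOrthogonalIdempotents S (e x) = 0 := Subtype.ext (by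
      change supportIdempotent e S * e x * supportIdempotent e S = 0
      rw [supportIdempotent_mul_eq_zero he.toOrthogonalIdempotents hx, zero_mul])
    rw [hφ, h0, map_zero]
    exact zero_smul (FullSubcat he.toOrthogonalIdempotents S)ᵐᵒᵖ (φ m)
  · intro h
    have hε : ∀ m : M.obj, MulOpposite.op (supportIdempotent e S) • m = m :=
      op_supportIdempotent_smul he h
    let inst : Module (FullSubcat he.toOrthogonalIdempotents S)ᵐᵒᵖ M.obj :=
      { smul := fun b m => MulOpposite.op (b.unop.1 : A) • m
        one_smul := hε
        mul_smul := fun b c m =>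
          mul_smul (MulOpposite.op (b.unop.1 : A)) (MulOpposite.op (c.unop.1 : A)) m
        smul_zero := fun b => smul_zero (MulOpposite.op (b.unop.1 : A))
        smul_add := fun b => smul_add (MulOpposite.op (b.unop.1 : A))
        add_smul := fun b c m =>
          add_smul (MulOpposite.op (b.unop.1 : A)) (MulOpposite.op (c.unop.1 : A)) m
        zero_smul := fun m => zero_smul Aᵐᵒᵖ m }
    have hcomp : ∀ (a : A) (m : M.obj), MulOpposite.op a • m =
        MulOpposite.op (compress he.toOrthogonalIdempotents S a) • m := fun a m => by
      change _ = MulOpposite.op (supportIdempotent e S * a * supportIdempotent e S) • m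
      rw [MulOpposite.op_mul, MulOpposite.op_mul, mul_smul, mul_smul, hε, hε]
    obtain ⟨hnt, htriv⟩ := (indecomposable_iff M.obj).1 M.indecomposable
    have hfin : Module.Finite (FullSubcat he.toOrthogonalIdempotents S)ᵐᵒᵖ M.obj := by
      obtain ⟨s, hs⟩ := M.finite.fg_top
      refine ⟨s, eq_top_iff.2 fun m _ => ?_⟩
      have hm : m ∈ Submodule.span Aᵐᵒᵖ (s : Set M.obj) := hs ▸ Submodule.mem_top
      induction hm using Submodule.span_induction with
      | mem x hx => exact Submodule.subset_span hx
      | zero => exact zero_mem _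
      | add x y _ _ hx hy => exact add_mem (hx trivial) (hy trivial)
      | smul a x _ hx =>
        rw [← MulOpposite.op_unop a, hcomp]
        exact Submodule.smul_mem _ _ (hx trivial)
    refine ⟨⟨ModuleCat.of _ M.obj, hfin, (indecomposable_iff _).2 ⟨hnt, fun p hp => ?_⟩⟩,
      AddEquiv.refl _, hcomp⟩
    let q : Module.End Aᵐᵒᵖ M.obj :=
      { toFun := fun m => p m
        map_add' := fun m n => map_add p m n
        map_smul' := fun a m => by
          change p (a • m) = a • p m
          rw [← MulOpposite.op_unop a, hcomp, hcomp]
          exact map_smul p _ m }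
    rcases htriv q (LinearMap.ext fun m => LinearMap.congr_fun hp m) with h0 | h1
    · exact Or.inl (LinearMap.ext fun m => LinearMap.congr_fun h0 m)
    · exact Or.inr (LinearMap.ext fun m => LinearMap.congr_fun h1 m)

end Support

/-! ## The left and right parts -/

section Parts

variable {A : Type u} [Ring A]

theorem Path.of_hom {M N : Ind A} (f : M.obj →ₗ[Aᵐᵒᵖ] N.obj) (hf : f ≠ 0) : Path M N :=
  Relation.TransGen.single ⟨ModuleCat.ofHom f, fun h => hf (congrArg ModuleCat.Hom.hom h)⟩

theorem leftPart_of_path {M N : Ind A} (h : Path M N) (hN : N ∈ leftPart A) : M ∈ leftPart A :=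
  fun L hL => hN L (Relation.TransGen.trans hL h)

theorem rightPart_of_path {M N : Ind A} (h : Path M N) (hM : M ∈ rightPart A) :
    N ∈ rightPart A :=
  fun L hL => hM L (Relation.TransGen.trans h hL)

theorem Ind.nontrivial (M : Ind A) : Nontrivial M.obj :=
  ((indecomposable_iff M.obj).1 M.indecomposable).1

theorem Ind.trivialIdempotents (M : Ind A) : TrivialIdempotents Aᵐᵒᵖ M.obj :=
  ((indecomposable_iff M.obj).1 M.indecomposable).2

theorem InAdd.of_pi {C : Set (Ind A)} {M : ModuleCat.{u} Aᵐᵒᵖ} {κ : Type*} [Fintype κ]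
    (X : κ → Ind A) (hX : ∀ k, X k ∈ C) (f : M ≃ₗ[Aᵐᵒᵖ] ((k : κ) → (X k).obj)) : InAdd C M :=
  ⟨Fintype.card κ, fun i => X ((Fintype.equivFin κ).symm i), fun _ => hX _,
    ⟨f ≪≫ₗ LinearEquiv.piCongrLeft' Aᵐᵒᵖ (fun k => (X k).obj) (Fintype.equivFin κ)⟩⟩

/-- The Krull–Schmidt input: it turns the condition on A ⊕ DA into one on each P_x and I_x. -/
theorem InAdd.liesIn_of_retract [IsNoetherianRing Aᵐᵒᵖ] [IsArtinianRing Aᵐᵒᵖ] {C : Set (Ind A)}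
    {M N : Type u} [AddCommGroup M] [Module Aᵐᵒᵖ M] [AddCommGroup N] [Module Aᵐᵒᵖ N]
    [Module.Finite Aᵐᵒᵖ N] [Nontrivial N] (hN : TrivialIdempotents Aᵐᵒᵖ N)
    (hM : InAdd C (ModuleCat.of Aᵐᵒᵖ M)) (s : N →ₗ[Aᵐᵒᵖ] M) (r : M →ₗ[Aᵐᵒᵖ] N)
    (hrs : ∀ n, r (s n) = n) : LiesIn C (ModuleCat.of Aᵐᵒᵖ N) := by
  obtain ⟨n, X, hX, ⟨f⟩⟩ := hM
  obtain ⟨k, ⟨g⟩⟩ := exists_linearEquiv_of_retract hN (fun k => (X k).obj)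
    (fun k => (X k).trivialIdempotents) (f.toLinearMap ∘ₗ s) (r ∘ₗ f.symm.toLinearMap)
    fun n => by
      change r (f.symm (f (s n))) = n
      rw [LinearEquiv.symm_apply_apply, hrs]
  exact ⟨X k, hX k, ⟨g.toModuleIso⟩⟩

theorem liesIn_union {C D : Set (Ind A)} {M : ModuleCat.{u} Aᵐᵒᵖ} :
    LiesIn (C ∪ D) M ↔ LiesIn C M ∨ LiesIn D M := by
  simp only [LiesIn, Set.mem_union, or_and_right, exists_or]

end Parts

/-! ## Ada algebras -/

section AdaAlgebra

variable (R : Type u) {A : Type u} [CommRing R] [IsArtinianRing R] [Ring A] [Algebra R A]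
  [Module.Finite R A]

/-- The indecomposable projective module `eA` of a primitive idempotent. -/
noncomputable def indProj {e : A} (he : IsIdempotentElem e) (h0 : e ≠ 0) (hprim : IsPrimitive e) :
    Ind A where
  obj := ModuleCat.of Aᵐᵒᵖ (projModule e)
  finite := inferInstanceAs (Module.Finite Aᵐᵒᵖ (projModule e))
  indecomposable := (indecomposable_iff _).2
    ⟨projModule.nontrivial h0, projModule.trivialIdempotents he hprim⟩

/-- The indecomposable injective module `D(Ae)` of a primitive idempotent. -/
noncomputable def indInj {e : A} (he : IsIdempotentElem e) (h0 : e ≠ 0) (hprim : IsPrimitive e) :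
    Ind A where
  obj := ModuleCat.of Aᵐᵒᵖ (injModule R e)
  finite := injModule.moduleFinite R e
  indecomposable := (indecomposable_iff _).2
    ⟨injModule.nontrivial R h0, injModule.trivialIdempotents R he hprim⟩

variable {ι : Type v} [Fintype ι] {e : ι → A}

theorem IsAda.liesIn_projModule (hA : IsAda R A) (he : IsBasicIdempotentSystem e) (x : ι) :
    LiesIn (leftPart A ∪ rightPart A) (ModuleCat.of Aᵐᵒᵖ (projModule (e x))) := by
  have := isNoetherianRing_mulOpposite R A
  have := isArtinianRing_mulOpposite R A
  have := projModule.nontrivial (he.ne_zero x)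
  exact hA.liesIn_of_retract (projModule.trivialIdempotents (he.idem x) (he.primitive x))
    (LinearMap.inl Aᵐᵒᵖ A (StdDual R A) ∘ₗ (projModule (e x)).subtype)
    (projRetraction (e x) ∘ₗ LinearMap.fst Aᵐᵒᵖ A (StdDual R A))
    (projRetraction_subtype (he.idem x))

theorem IsAda.liesIn_injModule (hA : IsAda R A) (he : IsBasicIdempotentSystem e) (x : ι) :
    LiesIn (leftPart A ∪ rightPart A) (ModuleCat.of Aᵐᵒᵖ (injModule R (e x))) := by
  have := isNoetherianRing_mulOpposite R A
  have := isArtinianRing_mulOpposite R A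
  have := injModule.nontrivial R (he.ne_zero x)
  have := injModule.moduleFinite R (e x)
  exact hA.liesIn_of_retract (injModule.trivialIdempotents R (he.idem x) (he.primitive x))
    (LinearMap.inr Aᵐᵒᵖ A (StdDual R A) ∘ₗ injInclusion R (e x))
    (injRestriction R (e x) ∘ₗ LinearMap.snd Aᵐᵒᵖ A (StdDual R A))
    (injRestriction_injInclusion R (he.idem x))

theorem IsAda.mem_indLeftSupport_or (hA : IsAda R A) (he : IsBasicIdempotentSystem e) (M : Ind A) :
    M ∈ indLeftSupport he.toOrthogonalIdempotents ∨ M ∈ rightPart A := by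
  refine or_iff_not_imp_left.2 fun hM => ?_
  rw [indLeftSupport, mem_indFullSubcat_iff he.toCompleteOrthogonalIdempotents] at hM
  push Not at hM
  obtain ⟨x, hx, m, hm⟩ := hM
  obtain ⟨X, hX, ⟨a⟩⟩ := (liesIn_union.1 (hA.liesIn_projModule R he x)).resolve_left hx
  obtain ⟨g, hg⟩ := exists_projModule_hom_ne_zero hm
  refine rightPart_of_path (Path.of_hom (g ∘ₗ a.toLinearEquiv.symm.toLinearMap) fun h => hg ?_) hX
  ext p
  simpa using LinearMap.congr_fun h (a.toLinearEquiv p)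

theorem IsAda.mem_leftPart_or (hA : IsAda R A) (he : IsBasicIdempotentSystem e) (M : Ind A) :
    M ∈ leftPart A ∨ M ∈ indRightSupport R he.toOrthogonalIdempotents := by
  refine or_iff_not_imp_right.2 fun hM => ?_
  rw [indRightSupport, mem_indFullSubcat_iff he.toCompleteOrthogonalIdempotents] at hM
  push Not at hM
  obtain ⟨x, hx, m, hm⟩ := hM
  obtain ⟨X, hX, ⟨a⟩⟩ := (liesIn_union.1 (hA.liesIn_injModule R he x)).resolve_right hx
  obtain ⟨g, hg⟩ := exists_injModule_hom_ne_zero R hm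
  refine leftPart_of_path (Path.of_hom (a.toLinearEquiv.toLinearMap ∘ₗ g) fun h => hg ?_) hX
  ext p : 1
  exact a.toLinearEquiv.injective ((LinearMap.congr_fun h p).trans (map_zero _).symm)

/-- If M e_x ≠ 0, then P_x is a predecessor of M, so it lies in the left part along with M. -/
theorem leftPart_subset_indLeftSupport (he : IsBasicIdempotentSystem e) :
    leftPart A ⊆ indLeftSupport he.toOrthogonalIdempotents := by
  intro M hM
  rw [indLeftSupport, mem_indFullSubcat_iff he.toCompleteOrthogonalIdempotents]
  intro x hx m
  by_contra hm
  obtain ⟨g, hg⟩ := exists_projModule_hom_ne_zero hm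
  exact hx ⟨indProj (he.idem x) (he.ne_zero x) (he.primitive x),
    leftPart_of_path (Path.of_hom g hg) hM, ⟨Iso.refl _⟩⟩

theorem isAda_of_forall_mem (he : IsBasicIdempotentSystem e)
    (h1 : ∀ M, M ∈ leftPart A ∨ M ∈ indRightSupport R he.toOrthogonalIdempotents)
    (h2 : ∀ M, M ∈ indLeftSupport he.toOrthogonalIdempotents ∨ M ∈ rightPart A) : IsAda R A := by
  let P : ι → Ind A := fun x => indProj (he.idem x) (he.ne_zero x) (he.primitive x)
  let I : ι → Ind A := fun x => indInj R (he.idem x) (he.ne_zero x) (he.primitive x)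
  have hP : ∀ x, P x ∈ leftPart A ∪ rightPart A := by
    intro x
    refine (h2 (P x)).imp_left fun h => ?_
    by_contra hx
    rw [indLeftSupport, mem_indFullSubcat_iff he.toCompleteOrthogonalIdempotents] at h
    -- Were x in the left support, P_x would be isomorphic to a module in the left part; the
    -- isomorphism is a nonzero map, hence a path, and puts P_x there too. So x is outside the
    -- support and e_x kills P_x, contradicting e_x e_x = e_x ≠ 0.
    have := h x (fun ⟨X, hX, ⟨a⟩⟩ => hx (leftPart_of_path (Path.of_hom a.toLinearEquiv.toLinearMap
      fun h0 => ?_) hX)) (projModule.gen (e x))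
    · have h3 : e x * e x = 0 := congrArg Subtype.val this
      exact he.ne_zero x ((he.idem x).eq.symm.trans h3)
    · have := (P x).nontrivial
      obtain ⟨p, hp⟩ := exists_ne (0 : (P x).obj)
      exact hp (a.toLinearEquiv.injective
        ((LinearMap.congr_fun h0 p).trans (map_zero _).symm))
  have hI : ∀ x, I x ∈ leftPart A ∪ rightPart A := by
    intro x
    refine (h1 (I x)).imp_right fun h => ?_
    by_contra hx
    rw [indRightSupport, mem_indFullSubcat_iff he.toCompleteOrthogonalIdempotents] at h
    obtain ⟨f, hf⟩ := exists_smul_injModule_ne_zero R (he.idem x) (he.ne_zero x)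
    -- The inverse isomorphism is used here, because the right part is closed under successors.
    refine hf (h x (fun ⟨X, hX, ⟨a⟩⟩ => hx (rightPart_of_path
      (Path.of_hom a.toLinearEquiv.symm.toLinearMap fun h0 => ?_) hX)) f)
    have := X.nontrivial
    obtain ⟨p, hp⟩ := exists_ne (0 : X.obj)
    exact hp (a.toLinearEquiv.symm.injective
      ((LinearMap.congr_fun h0 p).trans (map_zero _).symm))
  obtain ⟨f⟩ := nonempty_equiv_pi_projModule he.toCompleteOrthogonalIdempotents
  obtain ⟨g⟩ := nonempty_equiv_pi_injModule R he.toCompleteOrthogonalIdempotents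
  refine InAdd.of_pi (Sum.elim P I) (fun k => k.casesOn hP hI) ?_
  exact (f.prodCongr g) ≪≫ₗ
    (LinearEquiv.sumPiEquivProdPi Aᵐᵒᵖ ι ι fun k => (Sum.elim P I k).obj).symm

end AdaAlgebra

end Ada

theorem mainTheorem6 {R A : Type u} [CommRing R] [IsArtinianRing R] [Ring A] [Algebra R A]
    [Module.Finite R A] {ι : Type v} [Fintype ι] (e : ι → A)
    (he : Ada.IsBasicIdempotentSystem e) :
    (Ada.IsAda R A ↔
      (Set.univ = Ada.leftPart A ∪ Ada.indRightSupport R he.toOrthogonalIdempotents ∧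
        Set.univ = Ada.indLeftSupport he.toOrthogonalIdempotents ∪ Ada.rightPart A)) ∧
    (Ada.IsAda R A →
      (Set.univ : Set (Ada.Ind A)) =
        Ada.indLeftSupport he.toOrthogonalIdempotents ∪
          Ada.indRightSupport R he.toOrthogonalIdempotents) := by
  refine ⟨⟨fun hA => ⟨?_, ?_⟩, fun ⟨h1, h2⟩ => ?_⟩, fun hA => ?_⟩
  · exact (Set.eq_univ_of_forall (hA.mem_leftPart_or R he)).symm
  · exact (Set.eq_univ_of_forall (hA.mem_indLeftSupport_or R he)).symm
  · exact Ada.isAda_of_forall_mem R he (fun M => h1.subset (Set.mem_univ M))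
      (fun M => h2.subset (Set.mem_univ M))
  · exact (Set.eq_univ_of_forall fun M => (hA.mem_leftPart_or R he M).imp_left
      fun hM => Ada.leftPart_subset_indLeftSupport he hM).symm
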